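/- Let $M_n$ be the algebra of complex $n\times n$ matrices, let $\rho\in M_n$ be a faithful state ($\rho>0$, $\operatorname{Tr}\rho=1$) and let $A,B\in M_n$ be self-adjoint. Put $A_0=A-\operatorname{Tr}(\rho A)I$, $B_0=B-\operatorname{Tr}(\rho B)I$, $\mathrm{Cov}_\rho(A,B)=\operatorname{Tr}(\rho AB)-\operatorname{Tr}(\rho A)\operatorname{Tr}(\rho B)$, $\mathrm{Var}_\rho(A)=\mathrm{Cov}_\rho(A,A)$ and $\mathrm{Cov}^s_\rho(A,B)=\frac12[\mathrm{Cov}_\rho(A,B)+\mathrm{Cov}_\rho(B,A)]$. Let $f:(0,\infty)\to(0,\infty)$ be operator monotone (that is, $0\le f(X)\le f(Y)$ for all positive definite complex matrices $X\le Y$ of any size), symmetric ($f(x)=xf(x^{-1})$ for all $x>0$) and normalized ($f(1)=1$), and put $f(0)=\lim_{x\to0^+}f(x)$. With $L_\rho(X)=\rho X$, $R_\rho(X)=X\rho$ and $c_f(x,y)=\frac{1}{y\,f(x/y)}$, let $$\langle U,V\rangle_{\rho,f}=\operatorname{Tr}\bigl(U\cdot c_f(L_\rho,R_\rho)(V)\bigr)$$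 be the associated monotone metric (quantum Fisher information) on self-adjoint matrices, and let $$\mathrm{Area}^f_\rho(U,V)=\sqrt{\langle U,U\rangle_{\rho,f}\,\langle V,V\rangle_{\rho,f}-|\langle U,V\rangle_{\rho,f}|^2}.$$ Then equality holds in the inequality $$\mathrm{Var}_\rho(A)\,\mathrm{Var}_\rho(B)-|\mathrm{Cov}^s_\rho(A,B)|^2\;\ge\;\Bigl(\frac{f(0)}{2}\,\mathrm{Area}^f_\rho\bigl(i[\rho,A],i[\rho,B]\bigr)\Bigr)^2,$$ that is, $$\mathrm{Var}_\rho(A)\,\mathrm{Var}_\rho(B)-|\mathrm{Cov}^s_\rho(A,B)|^2=\Bigl(\frac{f(0)}{2}\,\mathrm{Area}^f_\rho\bigl(i[\rho,A],i[\rho,B]\bigr)\Bigr)^2,$$ if and only if $A_0$ and $B_0$ are proportional, i.e. $A_0=cB_0$ or $B_0=cA_0$ for some $c\in\mathbb R$. -/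

import Mathlib

open scoped Topology ComplexOrder

noncomputable section

namespace QuantumFisher

/-- `f : (0,∞) → ℝ` is operator monotone: `0 ≤ f(A) ≤ f(B)` for all positive definite complex
matrices `A ≤ B` of any size. Only the values of `f` on `(0,∞)` matter. -/
def OperatorMonotone (f : ℝ → ℝ) : Prop :=
  ∀ (k : ℕ) (A B : Matrix (Fin k) (Fin k) ℂ), A.PosDef → B.PosDef → (B - A).PosSemidef →
    (cfc f A).PosSemidef ∧ (cfc f B - cfc f A).PosSemidef

/-- The class of normalized symmetric operator monotone functions `(0,∞) → (0,∞)`, each represented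
by a function `ℝ → ℝ` of which only the values on `(0,∞)` matter. -/
structure IsFop (f : ℝ → ℝ) : Prop where
  pos : ∀ x, 0 < x → 0 < f x
  normalized : f 1 = 1
  symmetric : ∀ x, 0 < x → x * f x⁻¹ = f x
  operatorMonotone : OperatorMonotone f

/-- `f(0) := lim_{x → 0+} f(x)`; the limit exists by `IsFop.tendsto_valueAtZero`. -/
def valueAtZero (f : ℝ → ℝ) : ℝ := Filter.limUnder (𝓝[>] (0 : ℝ)) f

theorem IsFop.monotoneOn {f : ℝ → ℝ} (hf : IsFop f) : MonotoneOn f (Set.Ioi 0) := by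
  intro x hx y hy hxy
  have hd : ∀ r : ℝ, 0 < r → (algebraMap ℝ (Matrix (Fin 1) (Fin 1) ℂ) r).PosDef := by
    intro r hr
    rw [Algebra.algebraMap_eq_smul_one]
    exact Matrix.PosDef.one.smul hr
  have h := (hf.operatorMonotone 1 _ _ (hd x hx) (hd y hy) (by
    rw [← map_sub, Algebra.algebraMap_eq_smul_one]
    exact Matrix.PosSemidef.one.smul (sub_nonneg.2 hxy))).2
  rw [cfc_algebraMap, cfc_algebraMap, ← map_sub] at h
  have h0 := h.diag_nonneg (i := 0)
  simp only [Matrix.algebraMap_matrix_apply, if_true] at h0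
  have h1 : (0 : ℂ) ≤ ((f y - f x : ℝ) : ℂ) := by simpa using h0
  exact sub_nonneg.1 (Complex.zero_le_real.1 h1)

theorem IsFop.tendsto_valueAtZero {f : ℝ → ℝ} (hf : IsFop f) :
    Filter.Tendsto f (𝓝[>] 0) (𝓝 (valueAtZero f)) := by
  have h := hf.monotoneOn.tendsto_nhdsGT
    ⟨0, by rintro _ ⟨x, hx, rfl⟩; exact (hf.pos x hx).le⟩
  exact tendsto_nhds_limUnder ⟨_, h⟩

variable {n : ℕ}

/-- `Cov_ρ(A,B) = Tr(ρAB) - Tr(ρA) Tr(ρB)`. -/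
def cov (ρ A B : Matrix (Fin n) (Fin n) ℂ) : ℂ :=
  (ρ * A * B).trace - (ρ * A).trace * (ρ * B).trace

/-- `Var_ρ(A) = Cov_ρ(A,A)`, which is a real number for self-adjoint `ρ` and `A`. -/
def variance (ρ A : Matrix (Fin n) (Fin n) ℂ) : ℝ := (cov ρ A A).re

/-- The symmetrized covariance `½ (Cov_ρ(A,B) + Cov_ρ(B,A))`. -/
def symCov (ρ A B : Matrix (Fin n) (Fin n) ℂ) : ℂ := (1 / 2) * (cov ρ A B + cov ρ B A)

/-- `A₀ = A - Tr(ρA) I`. -/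
def centered (ρ A : Matrix (Fin n) (Fin n) ℂ) : Matrix (Fin n) (Fin n) ℂ :=
  A - (ρ * A).trace • 1

/-- The orthogonal projection onto the line spanned by the `i`-th vector of an orthonormal basis of
eigenvectors of `ρ`. -/
def eigenProj {ρ : Matrix (Fin n) (Fin n) ℂ} (hρ : ρ.IsHermitian) (i : Fin n) :
    Matrix (Fin n) (Fin n) ℂ :=
  Matrix.vecMulVec (⇑(hρ.eigenvectorBasis i)) (star ⇑(hρ.eigenvectorBasis i))

/-- The joint functional calculus `s(L_ρ, R_ρ) = ∑ᵢⱼ s(λᵢ, λⱼ) L_{Eᵢ} R_{Eⱼ}` of the commuting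
operators `L_ρ : X ↦ ρX` and `R_ρ : X ↦ Xρ`, with eigenvalues `λᵢ` of `ρ` listed with multiplicity.
It does not depend on the eigenbasis, since `s(λᵢ, λⱼ)` is constant on eigenspaces. -/
def leftRightCalculus {ρ : Matrix (Fin n) (Fin n) ℂ} (hρ : ρ.IsHermitian) (s : ℝ → ℝ → ℝ)
    (X : Matrix (Fin n) (Fin n) ℂ) : Matrix (Fin n) (Fin n) ℂ :=
  ∑ i, ∑ j, s (hρ.eigenvalues i) (hρ.eigenvalues j) • (eigenProj hρ i * X * eigenProj hρ j)

/-- The Chentsov-Morozova function `c_f(x,y) = 1 / (y f(x/y))`. -/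
def cmFunction (f : ℝ → ℝ) (x y : ℝ) : ℝ := 1 / (y * f (x / y))

/-- The monotone metric `⟨A,B⟩_{ρ,f} = Tr(A c_f(L_ρ,R_ρ)(B))` (quantum Fisher information), which is
a real number for self-adjoint `A` and `B`. -/
def metric {ρ : Matrix (Fin n) (Fin n) ℂ} (hρ : ρ.IsHermitian) (f : ℝ → ℝ)
    (A B : Matrix (Fin n) (Fin n) ℂ) : ℝ :=
  (A * leftRightCalculus hρ (cmFunction f) B).trace.re

/-- The area spanned by the tangent vectors `u`, `v` at `ρ` in the metric `⟨·,·⟩_{ρ,f}`. -/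
def area {ρ : Matrix (Fin n) (Fin n) ℂ} (hρ : ρ.IsHermitian) (f : ℝ → ℝ)
    (u v : Matrix (Fin n) (Fin n) ℂ) : ℝ :=
  √(metric hρ f u u * metric hρ f v v - |metric hρ f u v| ^ 2)

end QuantumFisher

end

/-! In an orthonormal eigenbasis of `ρ`, with eigenvalues `λᵢ`, both sides become Gram determinants
of the same two vectors, the matrices of `A₀` and `B₀`, for weighted inner products on entries. The
covariance has weights `p = (λᵢ + λⱼ)/2`, the metric on commutators `q = c_f(λᵢ, λⱼ)(λᵢ - λⱼ)²`.

The key fact is the strict bound `(f(0)/2) q < p` (`cmFunction_mul_sq_lt`), so `p = (f(0)/2) q + r`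
with all `r > 0`. Gram determinants are superadditive (`gram_det_add_le`), so equality leaves no
room for the determinant of `r`; by `exists_eq_smul_of_mul_le_sq` the vectors are then proportional.
Conversely, proportional vectors make both sides zero. -/

noncomputable section

namespace QuantumFisher

open Matrix

/-! ### Weighted inner products and Cauchy-Schwarz -/

section WeightedInner

variable {n : ℕ}

/-- The real bilinear form `∑ᵢⱼ wᵢⱼ Re(conj(xᵢⱼ) yᵢⱼ)` on complex matrices. -/
def weightedInner (w : Fin n → Fin n → ℝ) (X Y : Matrix (Fin n) (Fin n) ℂ) : ℝ :=
  ∑ i, ∑ j, w i j * (star (X i j) * Y i j).re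

variable (w v : Fin n → Fin n → ℝ) (X Y : Matrix (Fin n) (Fin n) ℂ)

theorem weightedInner_comm : weightedInner w X Y = weightedInner w Y X := by
  refine Finset.sum_congr rfl fun i _ => Finset.sum_congr rfl fun j _ => ?_
  simp only [Complex.star_def, Complex.mul_re, Complex.conj_re, Complex.conj_im]
  ring

theorem weightedInner_smul_left (c : ℝ) :
    weightedInner w (c • X) Y = c * weightedInner w X Y := by
  simp only [weightedInner, Finset.mul_sum]
  refine Finset.sum_congr rfl fun i _ => Finset.sum_congr rfl fun j _ => ?_
  simp
  ring

theorem weightedInner_smul_right (c : ℝ) :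
    weightedInner w X (c • Y) = c * weightedInner w X Y := by
  rw [weightedInner_comm, weightedInner_smul_left, weightedInner_comm]

theorem weightedInner_sub_weight :
    weightedInner (fun i j => w i j - v i j) X Y = weightedInner w X Y - weightedInner v X Y := by
  simp only [weightedInner, ← Finset.sum_sub_distrib, sub_mul]

theorem weightedInner_const_mul_weight (c : ℝ) :
    weightedInner (fun i j => c * w i j) X Y = c * weightedInner w X Y := by
  simp only [weightedInner, Finset.mul_sum, mul_assoc]

theorem weightedInner_sub_sub :
    weightedInner w (X - Y) (X - Y) =
      weightedInner w X X - 2 * weightedInner w X Y + weightedInner w Y Y := by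
  simp only [weightedInner, Finset.mul_sum, ← Finset.sum_sub_distrib, ← Finset.sum_add_distrib]
  refine Finset.sum_congr rfl fun i _ => Finset.sum_congr rfl fun j _ => ?_
  simp
  ring

theorem re_star_mul_self_nonneg (z : ℂ) : 0 ≤ (star z * z).re := by
  simp only [Complex.star_def, Complex.mul_re, Complex.conj_re, Complex.conj_im]
  nlinarith [mul_self_nonneg z.re, mul_self_nonneg z.im]

variable {w} in
theorem weightedInner_self_nonneg (hw : ∀ i j, 0 ≤ w i j) : 0 ≤ weightedInner w X X :=
  Finset.sum_nonneg fun i _ => Finset.sum_nonneg fun j _ =>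
    mul_nonneg (hw i j) (re_star_mul_self_nonneg _)

variable {w X} in
theorem eq_zero_of_weightedInner_self (hw : ∀ i j, 0 < w i j) (h : weightedInner w X X = 0) :
    X = 0 := by
  have hij : ∀ i j, 0 ≤ w i j * (star (X i j) * X i j).re := fun i j =>
    mul_nonneg (hw i j).le (re_star_mul_self_nonneg _)
  ext i j
  have h1 := (Finset.sum_eq_zero_iff_of_nonneg
    fun i _ => Finset.sum_nonneg fun j _ => hij i j).1 h i (Finset.mem_univ i)
  have h2 := (Finset.sum_eq_zero_iff_of_nonneg fun j _ => hij i j).1 h1 j (Finset.mem_univ j)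
  have h3 := (mul_eq_zero.1 h2).resolve_left (hw i j).ne'
  simp only [Complex.star_def, Complex.mul_re, Complex.conj_re, Complex.conj_im] at h3
  apply Complex.ext <;> simp only [Matrix.zero_apply, Complex.zero_re, Complex.zero_im] <;>
    nlinarith [mul_self_nonneg (X i j).re, mul_self_nonneg (X i j).im]

variable {w} in
/-- The Cauchy-Schwarz inequality. -/
theorem weightedInner_sq_le (hw : ∀ i j, 0 ≤ w i j) :
    weightedInner w X Y ^ 2 ≤ weightedInner w X X * weightedInner w Y Y := by
  have h : ∀ t : ℝ, 0 ≤ weightedInner w Y Y * (t * t) + (-2 * weightedInner w X Y) * t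
      + weightedInner w X X := fun t => by
    have := weightedInner_self_nonneg (X - t • Y) hw
    rw [weightedInner_sub_sub, weightedInner_smul_right, weightedInner_smul_left,
      weightedInner_smul_right] at this
    linarith
  have := discrim_le_zero h
  rw [discrim] at this
  nlinarith

variable {w X Y} in
/-- The equality case of the Cauchy-Schwarz inequality. -/
theorem exists_eq_smul_of_mul_le_sq (hw : ∀ i j, 0 < w i j)
    (h : weightedInner w X X * weightedInner w Y Y ≤ weightedInner w X Y ^ 2) :
    (∃ c : ℝ, X = c • Y) ∨ ∃ c : ℝ, Y = c • X := by
  by_cases hY : weightedInner w Y Y = 0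
  · exact Or.inr ⟨0, by rw [eq_zero_of_weightedInner_self hw hY, zero_smul]⟩
  -- The coefficient of the orthogonal projection of `X` onto `Y`; the residual has norm zero.
  refine Or.inl ⟨weightedInner w X Y / weightedInner w Y Y, sub_eq_zero.1 ?_⟩
  refine eq_zero_of_weightedInner_self hw ?_
  have h' := le_antisymm h (weightedInner_sq_le X Y fun i j => (hw i j).le)
  rw [weightedInner_sub_sub, weightedInner_smul_right, weightedInner_smul_left,
    weightedInner_smul_right]
  field_simp
  linear_combination h'

end WeightedInner

/-- Superadditivity of the determinant for positive semidefinite real `2 × 2` matrices. -/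
theorem gram_det_add_le {a b c a' b' c' : ℝ} (ha : 0 ≤ a) (hc : 0 ≤ c) (ha' : 0 ≤ a')
    (hc' : 0 ≤ c') (h : b ^ 2 ≤ a * c) (h' : b' ^ 2 ≤ a' * c') :
    (a * c - b ^ 2) + (a' * c' - b' ^ 2) ≤ (a + a') * (c + c') - (b + b') ^ 2 := by
  -- `(bb')² ≤ (ac')(a'c)`, then AM-GM.
  have key : 2 * (b * b') ≤ a * c' + a' * c := by
    refine le_of_sq_le_sq ?_ (by positivity)
    have := mul_le_mul h h' (sq_nonneg _) (by positivity)
    nlinarith [sq_nonneg (a * c' - a' * c)]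
  linarith

/-! ### Bounds on `f` in terms of `f(0)` -/

namespace IsFop

variable {f : ℝ → ℝ}

theorem valueAtZero_nonneg (hf : IsFop f) : 0 ≤ valueAtZero f :=
  ge_of_tendsto hf.tendsto_valueAtZero (eventually_mem_nhdsWithin.mono fun x hx => (hf.pos x hx).le)

theorem valueAtZero_le (hf : IsFop f) {x : ℝ} (hx : 0 < x) : valueAtZero f ≤ f x := by
  refine le_of_tendsto hf.tendsto_valueAtZero ?_
  filter_upwards [Ioo_mem_nhdsGT hx] with y hy
  exact hf.monotoneOn hy.1 hx hy.2.le

theorem valueAtZero_mul_le (hf : IsFop f) {x : ℝ} (hx : 0 < x) : x * valueAtZero f ≤ f x := by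
  rw [← hf.symmetric x hx]
  exact mul_le_mul_of_nonneg_left (hf.valueAtZero_le (inv_pos.2 hx)) hx.le

/-- The function `½ ((x + 1) - (x - 1)² f(0) / f(x))` associated with `f` is positive. -/
theorem valueAtZero_mul_sq_lt (hf : IsFop f) {x : ℝ} (hx : 0 < x) :
    valueAtZero f * (x - 1) ^ 2 < (x + 1) * f x := by
  have h0 := hf.valueAtZero_nonneg
  have hfx := hf.pos x hx
  -- For `x ≤ 1` use `f(0) ≤ f(x)` and `(x - 1)² ≤ 1`; for `x ≥ 1` use `x f(0) ≤ f(x)` and `(x - 1)²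
  -- ≤ x(x + 1)`. Positivity of `f(x)` gives strictness.
  rcases le_total x 1 with h1 | h1
  · have := hf.valueAtZero_le hx
    nlinarith [mul_nonneg h0 (by nlinarith : 0 ≤ 1 - (x - 1) ^ 2)]
  · have := hf.valueAtZero_mul_le hx
    nlinarith [mul_nonneg h0 (by nlinarith : 0 ≤ x - (x - 1) ^ 2 + x ^ 2)]

theorem cmFunction_pos (hf : IsFop f) {x y : ℝ} (hx : 0 < x) (hy : 0 < y) :
    0 < cmFunction f x y :=
  one_div_pos.2 (mul_pos hy (hf.pos _ (div_pos hx hy)))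

/-- The previous bound at `x / y`, made homogeneous. Its strictness is what makes the remainder
weight `r` definite. -/
theorem cmFunction_mul_sq_lt (hf : IsFop f) {x y : ℝ} (hx : 0 < x) (hy : 0 < y) :
    valueAtZero f / 2 * (cmFunction f x y * (x - y) ^ 2) < (x + y) / 2 := by
  have h := hf.valueAtZero_mul_sq_lt (div_pos hx hy)
  have hp := hf.pos _ (div_pos hx hy)
  have e1 : x / y - 1 = (x - y) / y := by field_simp
  have e2 : x / y + 1 = (x + y) / y := by field_simp
  rw [e1, e2, div_pow, mul_div_assoc', div_mul_eq_mul_div, div_lt_div_iff₀ (by positivity) hy] at h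
  have h' : valueAtZero f * (x - y) ^ 2 < (x + y) * (y * f (x / y)) := by
    refine lt_of_mul_lt_mul_right (a := y) ?_ hy.le
    linarith
  calc valueAtZero f / 2 * (cmFunction f x y * (x - y) ^ 2)
      = valueAtZero f * (x - y) ^ 2 / (y * f (x / y)) / 2 := by rw [cmFunction]; ring
    _ < (x + y) / 2 := by
      gcongr
      exact (div_lt_iff₀ (by positivity)).2 h'

end IsFop

/-! ### Passage to the eigenbasis of `ρ` -/

section Eigenbasis

variable {n : ℕ} {ρ : Matrix (Fin n) (Fin n) ℂ} (hρ : ρ.IsHermitian)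

/-- The matrix of `X` in the chosen orthonormal eigenbasis of `ρ`. -/
def inEigenbasis (X : Matrix (Fin n) (Fin n) ℂ) : Matrix (Fin n) (Fin n) ℂ :=
  star (hρ.eigenvectorUnitary : Matrix (Fin n) (Fin n) ℂ) * X * hρ.eigenvectorUnitary

theorem inEigenbasis_mul (X Y : Matrix (Fin n) (Fin n) ℂ) :
    inEigenbasis hρ (X * Y) = inEigenbasis hρ X * inEigenbasis hρ Y := by
  have h : (hρ.eigenvectorUnitary : Matrix (Fin n) (Fin n) ℂ) *
      star (hρ.eigenvectorUnitary : Matrix (Fin n) (Fin n) ℂ) = 1 := Unitary.coe_mul_star_self _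
  simp only [inEigenbasis, Matrix.mul_assoc]
  rw [← Matrix.mul_assoc (hρ.eigenvectorUnitary : Matrix (Fin n) (Fin n) ℂ) (star _), h,
    Matrix.one_mul]

theorem inEigenbasis_sub (X Y : Matrix (Fin n) (Fin n) ℂ) :
    inEigenbasis hρ (X - Y) = inEigenbasis hρ X - inEigenbasis hρ Y := by
  simp only [inEigenbasis, Matrix.mul_sub, Matrix.sub_mul]

theorem inEigenbasis_complex_smul (c : ℂ) (X : Matrix (Fin n) (Fin n) ℂ) :
    inEigenbasis hρ (c • X) = c • inEigenbasis hρ X := by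
  simp only [inEigenbasis, Matrix.mul_smul, Matrix.smul_mul]

theorem inEigenbasis_smul (c : ℝ) (X : Matrix (Fin n) (Fin n) ℂ) :
    inEigenbasis hρ (c • X) = c • inEigenbasis hρ X := by
  simp only [inEigenbasis, Matrix.mul_smul, Matrix.smul_mul]

theorem inEigenbasis_injective : Function.Injective (inEigenbasis hρ) := by
  have h : (hρ.eigenvectorUnitary : Matrix (Fin n) (Fin n) ℂ) *
      star (hρ.eigenvectorUnitary : Matrix (Fin n) (Fin n) ℂ) = 1 := Unitary.coe_mul_star_self _
  intro X Y hXY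
  have := congrArg (fun Z => (hρ.eigenvectorUnitary : Matrix (Fin n) (Fin n) ℂ) * Z *
    star (hρ.eigenvectorUnitary : Matrix (Fin n) (Fin n) ℂ)) hXY
  simpa only [inEigenbasis, Matrix.mul_assoc, h, Matrix.mul_one, ← Matrix.mul_assoc _ (star _),
    Matrix.one_mul] using this

theorem trace_inEigenbasis (X : Matrix (Fin n) (Fin n) ℂ) :
    (inEigenbasis hρ X).trace = X.trace := by
  rw [inEigenbasis, Matrix.mul_assoc, Matrix.trace_mul_comm, Matrix.mul_assoc,
    show (hρ.eigenvectorUnitary : Matrix (Fin n) (Fin n) ℂ) *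
      star (hρ.eigenvectorUnitary : Matrix (Fin n) (Fin n) ℂ) = 1 from Unitary.coe_mul_star_self _,
    Matrix.mul_one]

theorem isHermitian_inEigenbasis {X : Matrix (Fin n) (Fin n) ℂ} (hX : X.IsHermitian) :
    (inEigenbasis hρ X).IsHermitian :=
  isHermitian_conjTranspose_mul_mul _ hX

theorem inEigenbasis_self : inEigenbasis hρ ρ = diagonal fun i => (hρ.eigenvalues i : ℂ) := by
  have := hρ.conjStarAlgAut_star_eigenvectorUnitary
  rw [Unitary.conjStarAlgAut_star_apply] at this
  exact this

theorem inEigenbasis_eigenProj (i : Fin n) :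
    inEigenbasis hρ (eigenProj hρ i) = Matrix.single i i 1 := by
  rw [inEigenbasis, eigenProj, mul_vecMulVec, vecMulVec_mul, hρ.star_eigenvectorUnitary_mulVec,
    single_eq_single_vecMulVec_single]
  congr 1
  have := congrArg star (hρ.star_eigenvectorUnitary_mulVec i)
  rw [star_mulVec, ← star_eq_conjTranspose, star_star] at this
  rw [this]
  ext j
  simp [Pi.single_apply, apply_ite]

theorem inEigenbasis_commutator_apply (X : Matrix (Fin n) (Fin n) ℂ) (i j : Fin n) :
    inEigenbasis hρ (Complex.I • ⁅ρ, X⁆) i j =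
      Complex.I * ((hρ.eigenvalues i - hρ.eigenvalues j : ℝ) * inEigenbasis hρ X i j) := by
  rw [Ring.lie_def, inEigenbasis_complex_smul, inEigenbasis_sub, inEigenbasis_mul,
    inEigenbasis_mul, inEigenbasis_self]
  simp only [Matrix.smul_apply, Matrix.sub_apply, diagonal_mul, mul_diagonal, smul_eq_mul]
  push_cast
  ring

theorem trace_mul_eigenProj_mul_eigenProj (X Y : Matrix (Fin n) (Fin n) ℂ) (i j : Fin n) :
    (X * (eigenProj hρ i * Y * eigenProj hρ j)).trace =
      inEigenbasis hρ X j i * inEigenbasis hρ Y i j := by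
  rw [← trace_inEigenbasis hρ]
  simp only [inEigenbasis_mul, inEigenbasis_eigenProj]
  simp [Matrix.trace_mul_single]

/-- The commutator multiplies entry `(i, j)` by `i(λᵢ - λⱼ)`. The trace pairs entry `(j, i)` with
`(i, j)`, so the sign from `i²` cancels the one from the opposite differences. -/
theorem metric_eq_weightedInner (f : ℝ → ℝ) {X : Matrix (Fin n) (Fin n) ℂ} (hX : X.IsHermitian)
    (Y : Matrix (Fin n) (Fin n) ℂ) :
    metric hρ f (Complex.I • ⁅ρ, X⁆) (Complex.I • ⁅ρ, Y⁆) =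
      weightedInner (fun i j => cmFunction f (hρ.eigenvalues i) (hρ.eigenvalues j) *
          (hρ.eigenvalues i - hρ.eigenvalues j) ^ 2)
        (inEigenbasis hρ X) (inEigenbasis hρ Y) := by
  simp only [metric, leftRightCalculus, weightedInner, Matrix.mul_sum, Matrix.trace_sum,
    Complex.re_sum]
  refine Finset.sum_congr rfl fun i _ => Finset.sum_congr rfl fun j _ => ?_
  rw [Matrix.mul_smul, Matrix.trace_smul, trace_mul_eigenProj_mul_eigenProj, Complex.smul_re,
    inEigenbasis_commutator_apply, inEigenbasis_commutator_apply, smul_eq_mul,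
    ← (isHermitian_inEigenbasis hρ hX).apply j i]
  generalize inEigenbasis hρ X i j = x
  generalize inEigenbasis hρ Y i j = y
  have : Complex.I * ((hρ.eigenvalues j - hρ.eigenvalues i : ℝ) * star x) *
      (Complex.I * ((hρ.eigenvalues i - hρ.eigenvalues j : ℝ) * y)) =
      (((hρ.eigenvalues i - hρ.eigenvalues j) ^ 2 : ℝ) : ℂ) * (star x * y) := by
    push_cast
    linear_combination (-(hρ.eigenvalues i - hρ.eigenvalues j : ℂ) ^ 2 * (star x * y)) *
      Complex.I_mul_I
  rw [this, Complex.re_ofReal_mul, mul_assoc]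

theorem half_trace_add_eq_weightedInner {X Y : Matrix (Fin n) (Fin n) ℂ} (hX : X.IsHermitian)
    (hY : Y.IsHermitian) :
    (1 / 2) * ((ρ * X * Y).trace + (ρ * Y * X).trace) =
      ((weightedInner (fun i j => (hρ.eigenvalues i + hρ.eigenvalues j) / 2)
        (inEigenbasis hρ X) (inEigenbasis hρ Y) : ℝ) : ℂ) := by
  have key : ∀ X Y : Matrix (Fin n) (Fin n) ℂ, (ρ * X * Y).trace =
      ∑ i, ∑ j, hρ.eigenvalues i * (inEigenbasis hρ X i j * inEigenbasis hρ Y j i) := by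
    intro X Y
    rw [← trace_inEigenbasis hρ, inEigenbasis_mul, inEigenbasis_mul, inEigenbasis_self]
    simp only [Matrix.trace, diag_apply, mul_apply (N := inEigenbasis hρ Y), diagonal_mul,
      mul_assoc, Finset.mul_sum]
  have hx := (isHermitian_inEigenbasis hρ hX).apply
  have hy := (isHermitian_inEigenbasis hρ hY).apply
  set x := inEigenbasis hρ X
  set y := inEigenbasis hρ Y
  have h1 : (ρ * X * Y).trace + (ρ * Y * X).trace =
      ∑ i, ∑ j, ((hρ.eigenvalues i + hρ.eigenvalues j : ℝ) : ℂ) * (star (x i j) * y i j) := by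
    rw [key X Y, key Y X, Finset.sum_comm, ← Finset.sum_add_distrib]
    refine Finset.sum_congr rfl fun i _ => ?_
    rw [← Finset.sum_add_distrib]
    refine Finset.sum_congr rfl fun j _ => ?_
    rw [hx j i]
    push_cast
    ring
  have h2 : (ρ * X * Y).trace + (ρ * Y * X).trace =
      ∑ i, ∑ j, ((hρ.eigenvalues i + hρ.eigenvalues j : ℝ) : ℂ) * (x i j * star (y i j)) := by
    rw [key X Y, key Y X, add_comm, Finset.sum_comm, ← Finset.sum_add_distrib]
    refine Finset.sum_congr rfl fun i _ => ?_
    rw [← Finset.sum_add_distrib]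
    refine Finset.sum_congr rfl fun j _ => ?_
    rw [hy j i]
    push_cast
    ring
  -- Averaging the two conjugate expansions `h1` and `h2` makes every summand real.
  have h3 : (1 / 2) * ((ρ * X * Y).trace + (ρ * Y * X).trace) =
      (1 / 4) * (((ρ * X * Y).trace + (ρ * Y * X).trace) +
        ((ρ * X * Y).trace + (ρ * Y * X).trace)) := by ring
  rw [h3]
  nth_rewrite 1 [h1]
  rw [h2, ← Finset.sum_add_distrib, weightedInner, Finset.mul_sum, Complex.ofReal_sum]
  refine Finset.sum_congr rfl fun i _ => ?_
  rw [← Finset.sum_add_distrib, Finset.mul_sum, Complex.ofReal_sum]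
  refine Finset.sum_congr rfl fun j _ => ?_
  have h4 : star (x i j) * y i j + x i j * star (y i j) =
      ((2 * (star (x i j) * y i j).re : ℝ) : ℂ) := by
    rw [← Complex.add_conj]
    simp
  rw [← mul_add, h4]
  push_cast
  ring

end Eigenbasis

/-! ### Centered observables -/

section Centered

variable {n : ℕ} {ρ : Matrix (Fin n) (Fin n) ℂ}

theorem isHermitian_centered (hρ : ρ.IsHermitian) {A : Matrix (Fin n) (Fin n) ℂ}
    (hA : A.IsHermitian) : (centered ρ A).IsHermitian := by
  refine hA.sub (isHermitian_one.smul ?_)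
  rw [IsSelfAdjoint, ← trace_conjTranspose, conjTranspose_mul, hA.eq, hρ.eq, trace_mul_comm]

theorem cov_eq_trace_centered (hρ1 : ρ.trace = 1) (A B : Matrix (Fin n) (Fin n) ℂ) :
    cov ρ A B = (ρ * centered ρ A * centered ρ B).trace := by
  simp only [cov, centered, Matrix.mul_sub, Matrix.sub_mul, Matrix.mul_smul, Matrix.smul_mul,
    Matrix.mul_one, trace_sub, trace_smul, hρ1, smul_eq_mul]
  ring

/-- Scalars commute with `ρ`, so the metric side too can be written in the centered observables. -/
theorem commutator_centered (A : Matrix (Fin n) (Fin n) ℂ) : ⁅ρ, centered ρ A⁆ = ⁅ρ, A⁆ := by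
  simp only [Ring.lie_def, centered, Matrix.mul_sub, Matrix.sub_mul, Matrix.mul_smul,
    Matrix.smul_mul, Matrix.mul_one, Matrix.one_mul]
  abel

theorem symCov_eq_weightedInner (hρ : ρ.IsHermitian) (hρ1 : ρ.trace = 1)
    {A B : Matrix (Fin n) (Fin n) ℂ} (hA : A.IsHermitian) (hB : B.IsHermitian) :
    symCov ρ A B = ((weightedInner (fun i j => (hρ.eigenvalues i + hρ.eigenvalues j) / 2)
      (inEigenbasis hρ (centered ρ A)) (inEigenbasis hρ (centered ρ B)) : ℝ) : ℂ) := by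
  rw [symCov, cov_eq_trace_centered hρ1, cov_eq_trace_centered hρ1,
    half_trace_add_eq_weightedInner hρ (isHermitian_centered hρ hA) (isHermitian_centered hρ hB)]

theorem variance_eq_re_symCov (A : Matrix (Fin n) (Fin n) ℂ) :
    variance ρ A = (symCov ρ A A).re := by
  rw [variance, symCov, ← two_mul, ← mul_assoc]
  norm_num

end Centered

end QuantumFisher

end

/-! ### The equality case -/

open QuantumFisher in
theorem mainTheorem2 {n : ℕ} (ρ A B : Matrix (Fin n) (Fin n) ℂ)
    (hρ : ρ.PosDef) (hρ1 : ρ.trace = 1) (hA : A.IsHermitian) (hB : B.IsHermitian)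
    (f : ℝ → ℝ) (hf : QuantumFisher.IsFop f) :
    QuantumFisher.variance ρ A * QuantumFisher.variance ρ B
          - ‖QuantumFisher.symCov ρ A B‖ ^ 2
        = (QuantumFisher.valueAtZero f / 2 *
            QuantumFisher.area hρ.isHermitian f
              (Complex.I • ⁅ρ, A⁆) (Complex.I • ⁅ρ, B⁆)) ^ 2
      ↔ (∃ c : ℝ, QuantumFisher.centered ρ A = c • QuantumFisher.centered ρ B) ∨
        (∃ c : ℝ, QuantumFisher.centered ρ B = c • QuantumFisher.centered ρ A) := by
  set a := inEigenbasis hρ.isHermitian (centered ρ A) with ha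
  set b := inEigenbasis hρ.isHermitian (centered ρ B) with hb
  set p : Fin n → Fin n → ℝ := fun i j =>
    (hρ.isHermitian.eigenvalues i + hρ.isHermitian.eigenvalues j) / 2 with hp
  set q : Fin n → Fin n → ℝ := fun i j =>
    cmFunction f (hρ.isHermitian.eigenvalues i) (hρ.isHermitian.eigenvalues j) *
      (hρ.isHermitian.eigenvalues i - hρ.isHermitian.eigenvalues j) ^ 2 with hq
  have hq0 : ∀ i j, 0 ≤ q i j := fun i j =>
    mul_nonneg (hf.cmFunction_pos (hρ.eigenvalues_pos i) (hρ.eigenvalues_pos j)).le (sq_nonneg _)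
  have hr0 : ∀ i j, 0 < p i j - valueAtZero f / 2 * q i j := fun i j =>
    sub_pos.2 (hf.cmFunction_mul_sq_lt (hρ.eigenvalues_pos i) (hρ.eigenvalues_pos j))
  -- This makes the radicand in `area` nonnegative, so squaring removes the root. The weight `q`
  -- vanishes on the diagonal, hence is only semidefinite.
  have hcs := weightedInner_sq_le a b hq0
  have hAc := isHermitian_centered hρ.isHermitian hA
  have hBc := isHermitian_centered hρ.isHermitian hB
  rw [variance_eq_re_symCov, variance_eq_re_symCov,
    symCov_eq_weightedInner hρ.isHermitian hρ1 hA hA,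
    symCov_eq_weightedInner hρ.isHermitian hρ1 hB hB,
    symCov_eq_weightedInner hρ.isHermitian hρ1 hA hB,
    Complex.norm_real, Real.norm_eq_abs, sq_abs, Complex.ofReal_re, Complex.ofReal_re, area,
    ← commutator_centered A, ← commutator_centered B,
    metric_eq_weightedInner _ f hAc, metric_eq_weightedInner _ f hBc,
    metric_eq_weightedInner _ f hAc, sq_abs, ← ha, ← hb, ← hp, ← hq, mul_pow,
    Real.sq_sqrt (sub_nonneg.2 hcs)]
  constructor
  · intro h
    have hr := fun X Y : Matrix (Fin n) (Fin n) ℂ =>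
      weightedInner_sub_weight p (fun i j => valueAtZero f / 2 * q i j) X Y
    simp only [weightedInner_const_mul_weight] at hr
    have hf0 : 0 ≤ valueAtZero f / 2 := div_nonneg hf.valueAtZero_nonneg zero_le_two
    set r : Fin n → Fin n → ℝ := fun i j => p i j - valueAtZero f / 2 * q i j
    have hdet := gram_det_add_le
      (mul_nonneg hf0 (weightedInner_self_nonneg a hq0))
      (mul_nonneg hf0 (weightedInner_self_nonneg b hq0))
      (weightedInner_self_nonneg a fun i j => (hr0 i j).le)
      (weightedInner_self_nonneg b fun i j => (hr0 i j).le)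
      (b := valueAtZero f / 2 * weightedInner q a b)
      (by nlinarith [mul_le_mul_of_nonneg_left hcs (sq_nonneg (valueAtZero f / 2))])
      (weightedInner_sq_le a b fun i j => (hr0 i j).le)
    -- By `h`, the determinant for `p` equals the one for `(f(0)/2) q`, so superadditivity forces
    -- that of `r` to be at most zero.
    have hle : weightedInner r a a * weightedInner r b b ≤ weightedInner r a b ^ 2 := by
      have e : ∀ X Y, valueAtZero f / 2 * weightedInner q X Y + weightedInner r X Y =
        weightedInner p X Y := fun X Y => by rw [hr]; ring
      rw [e, e, e, h] at hdet
      linarith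
    refine (exists_eq_smul_of_mul_le_sq hr0 hle).imp ?_ ?_ <;> rintro ⟨c, hc⟩ <;>
      exact ⟨c, inEigenbasis_injective hρ.isHermitian (by rw [inEigenbasis_smul]; exact hc)⟩
  · rintro (⟨c, hc⟩ | ⟨c, hc⟩)
    · have hab : a = c • b := by rw [ha, hb, hc, inEigenbasis_smul]
      simp only [hab, weightedInner_smul_left, weightedInner_smul_right]
      ring
    · have hab : b = c • a := by rw [ha, hb, hc, inEigenbasis_smul]
      simp only [hab, weightedInner_smul_left, weightedInner_smul_right]
      ring
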